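/- For complex numbers $a$ and $q$ with $|q|<1$ put $(a;q)_n=\prod_{k=0}^{n-1}(1-aq^k)$ for integers $n\ge 0$, and $(a;q)_\infty=\prod_{k=0}^{\infty}(1-aq^k)$. For integers $n,k$ let $$\left[\begin{matrix}n\\k\end{matrix}\right]=\begin{cases}\dfrac{(q;q)_n}{(q;q)_k\,(q;q)_{n-k}}, & 0\le k\le n,\\[2mm] 0, & \text{otherwise.}\end{cases}$$ Put $a_0(q)=0$, $b_0(q)=1$, and for integers $m\ge 1$ $$a_m(q)=\sum_{n,l\ge 0} q^{n(n-1)/2+l(l+1)/2}\left[\begin{matrix}m-1-l\\n\end{matrix}\right]\left[\begin{matrix}n\\l\end{matrix}\right],\qquad b_m(q)=\sum_{n,l\ge 0} q^{n(n+1)/2+l(l+1)/2}\left[\begin{matrix}m-2-l\\n\end{matrix}\right]\left[\begin{matrix}n\\l\end{matrix}\right]$$ (only finitely many terms are nonzero). **Corollary.** Let $m\ge 0$ be an integer and let $q$ be a complex number with $|q|<1$, and $q\neq 0$ if $m\ge 2$. Then the series below converges and $$\sum_{n=0}^{\infty}\frac{(-q;q)_n\,q^{n(n-1)/2+mn}}{(q;q)_n}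 =\frac{(-1)^{m-1}}{q^{m(m-1)/2}}\left[\bigl(a_m(q)-b_m(q)\bigr)\frac{(q^4;q^4)_\infty}{(q;q)_\infty}-b_m(q)\frac{(-q;q^2)_\infty}{(q;q^2)_\infty}\right],$$ where $0^0=1$. -/

import Mathlib

/-- The finite `q`-shifted factorial `(a; q)_n = ∏_{k = 0}^{n - 1} (1 - a q^k)`. -/
noncomputable def qPoch (a q : ℂ) (n : ℕ) : ℂ :=
  ∏ k ∈ Finset.range n, (1 - a * q ^ k)

/-- The infinite `q`-shifted factorial `(a; q)_∞ = ∏_{k = 0}^∞ (1 - a q^k)`. -/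
noncomputable def qPochInf (a q : ℂ) : ℂ :=
  ∏' k : ℕ, (1 - a * q ^ k)

/-- The product defining `(a; q)_∞` converges for `|q| < 1`. -/
theorem multipliable_qPochInf (a q : ℂ) (hq : ‖q‖ < 1) :
    Multipliable fun k : ℕ => 1 - a * q ^ k := by
  have h : Summable fun k : ℕ => ‖-(a * q ^ k)‖ := by
    simpa [norm_mul, norm_pow] using
      (summable_geometric_of_lt_one (norm_nonneg q) hq).mul_left ‖a‖
  simpa [sub_eq_add_neg] using multipliable_one_add_of_summable h

/-- The Gaussian polynomial with entries `n` over `k`, evaluated at a complex number `q` with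
`|q| < 1` (so that the denominators do not vanish).  The entries are integers, and the value is
`0` unless `0 ≤ k ≤ n`. -/
noncomputable def gaussPoly (q : ℂ) (n k : ℤ) : ℂ :=
  if 0 ≤ k ∧ k ≤ n then
    qPoch q q n.toNat / (qPoch q q k.toNat * qPoch q q (n - k).toNat)
  else 0

/-- The `(n, l)` term of the double sum `a_m(q)`. -/
noncomputable def aTerm (q : ℂ) (m n l : ℕ) : ℂ :=
  q ^ (n * (n - 1) / 2 + l * (l + 1) / 2) *
    gaussPoly q ((m : ℤ) - 1 - l) n * gaussPoly q n l

/-- The `(n, l)` term of the double sum `b_m(q)`. -/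
noncomputable def bTerm (q : ℂ) (m n l : ℕ) : ℂ :=
  q ^ (n * (n + 1) / 2 + l * (l + 1) / 2) *
    gaussPoly q ((m : ℤ) - 2 - l) n * gaussPoly q n l

/-- Only the terms with `n, l < m` of the double sum `a_m(q)` can be nonzero. -/
theorem aTerm_eq_zero (q : ℂ) (m n l : ℕ) (h : m ≤ n ∨ m ≤ l) : aTerm q m n l = 0 := by
  have h1 : ¬(0 ≤ (n : ℤ) ∧ (n : ℤ) ≤ (m : ℤ) - 1 - l) := by omega
  unfold aTerm gaussPoly
  rw [if_neg h1, mul_zero, zero_mul]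

/-- Only the terms with `n, l < m` of the double sum `b_m(q)` can be nonzero. -/
theorem bTerm_eq_zero (q : ℂ) (m n l : ℕ) (h : m ≤ n ∨ m ≤ l) : bTerm q m n l = 0 := by
  have h1 : ¬(0 ≤ (n : ℤ) ∧ (n : ℤ) ≤ (m : ℤ) - 2 - l) := by omega
  unfold bTerm gaussPoly
  rw [if_neg h1, mul_zero, zero_mul]

/-- `a_0(q) = 0`, and for `m ≥ 1` the sum over all `n, l ≥ 0` of `aTerm q m n l`; all terms
outside the range of summation below vanish. -/
noncomputable def aSum (q : ℂ) (m : ℕ) : ℂ :=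
  if m = 0 then 0 else ∑ n ∈ Finset.range m, ∑ l ∈ Finset.range m, aTerm q m n l

/-- `b_0(q) = 1`, and for `m ≥ 1` the sum over all `n, l ≥ 0` of `bTerm q m n l`; all terms
outside the range of summation below vanish. -/
noncomputable def bSum (q : ℂ) (m : ℕ) : ℂ :=
  if m = 0 then 1 else ∑ n ∈ Finset.range m, ∑ l ∈ Finset.range m, bTerm q m n l

/-! Let `S(b, z)` be the series `qSeries q b z`; the left side is `S_m = S(-q, q^m)`. The
`q`-difference equation in `z` (`qSeries_sub`) links `S_m`, `S_(m+1)` and `S_(m+2)`. After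
multiplication by `(-1)^(m+1) q^(m(m-1)/2)` it becomes `x_(m+2) = (1 + q^m) x_(m+1) + q^m x_m`,
which `a_m` and `b_m` also satisfy, by the `q`-Pascal rules (`gaussSquareSum_recurrence`). Hence
only `m = 0, 1` need evaluation: `m = 1` is a case of Lebesgue's identity (`qSeries_self`), and `m =
0` follows from `S(-q, 1) = S(-q, q) + S(-1, q)`, a sum of two such cases. -/

open Filter Topology

/-! ### Finite and infinite `q`-shifted factorials. -/

theorem qPoch_zero (a q : ℂ) : qPoch a q 0 = 1 := by simp [qPoch]

theorem qPoch_succ (a q : ℂ) (n : ℕ) : qPoch a q (n + 1) = qPoch a q n * (1 - a * q ^ n) :=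
  Finset.prod_range_succ _ _

theorem qPoch_succ' (a q : ℂ) (n : ℕ) : qPoch a q (n + 1) = (1 - a) * qPoch (a * q) q n := by
  unfold qPoch
  rw [Finset.prod_range_succ', mul_comm]
  congr 1
  · simp
  · exact Finset.prod_congr rfl fun k _ => by ring

theorem one_sub_mul_pow_ne_zero {a q : ℂ} (ha : ‖a‖ < 1) (hq : ‖q‖ < 1) (k : ℕ) :
    1 - a * q ^ k ≠ 0 := by
  intro h
  have h1 : ‖a * q ^ k‖ = 1 := by rw [← sub_eq_zero.mp h, norm_one]
  rw [norm_mul, norm_pow] at h1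
  have h2 : ‖q‖ ^ k ≤ 1 := pow_le_one₀ (norm_nonneg _) hq.le
  nlinarith [norm_nonneg a]

theorem qPoch_self_ne_zero {q : ℂ} (hq : ‖q‖ < 1) (n : ℕ) : qPoch q q n ≠ 0 :=
  Finset.prod_ne_zero_iff.mpr fun k _ => one_sub_mul_pow_ne_zero hq hq k

theorem tendsto_qPoch (a : ℂ) {q : ℂ} (hq : ‖q‖ < 1) :
    Tendsto (qPoch a q) atTop (𝓝 (qPochInf a q)) :=
  (multipliable_qPochInf a q hq).tendsto_prod_tprod_nat

theorem qPochInf_ne_zero {a q : ℂ} (ha : ‖a‖ < 1) (hq : ‖q‖ < 1) : qPochInf a q ≠ 0 := by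
  have h : Summable fun k : ℕ => ‖-(a * q ^ k)‖ := by
    simpa [norm_mul, norm_pow] using
      (summable_geometric_of_lt_one (norm_nonneg q) hq).mul_left ‖a‖
  have := tprod_one_add_ne_zero_of_summable (f := fun k : ℕ => -(a * q ^ k))
    (fun k => by simpa [sub_eq_add_neg] using one_sub_mul_pow_ne_zero ha hq k) h
  simpa [qPochInf, sub_eq_add_neg] using this

theorem norm_sq_lt_one {q : ℂ} (hq : ‖q‖ < 1) : ‖q ^ 2‖ < 1 := by
  rw [norm_pow]; exact pow_lt_one₀ (norm_nonneg _) hq two_ne_zero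

theorem qPochInf_mul_neg (a : ℂ) {q : ℂ} (hq : ‖q‖ < 1) :
    qPochInf a q * qPochInf (-a) q = qPochInf (a ^ 2) (q ^ 2) := by
  unfold qPochInf
  rw [← (multipliable_qPochInf a q hq).tprod_mul (multipliable_qPochInf (-a) q hq)]
  exact tprod_congr fun k => by ring

theorem qPochInf_even_mul_odd (a : ℂ) {q : ℂ} (hq : ‖q‖ < 1) :
    qPochInf a (q ^ 2) * qPochInf (a * q) (q ^ 2) = qPochInf a q := by
  have he := multipliable_qPochInf a (q ^ 2) (norm_sq_lt_one hq)
  have ho := multipliable_qPochInf (a * q) (q ^ 2) (norm_sq_lt_one hq)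
  have h1 : (fun k : ℕ => 1 - a * (q ^ 2) ^ k) = fun k => 1 - a * q ^ (2 * k) := by
    funext k; rw [pow_mul]
  have h2 : (fun k : ℕ => 1 - a * q * (q ^ 2) ^ k) = fun k => 1 - a * q ^ (2 * k + 1) := by
    funext k; rw [← pow_mul]; ring
  unfold qPochInf
  rw [h1] at he ⊢
  rw [h2] at ho ⊢
  exact tprod_even_mul_odd (f := fun k => 1 - a * q ^ k) he ho

/-! ### The series, its `q`-difference equations and Lebesgue's identity. -/

/-- The general term of the series `∑ (b; q)_n q^(n(n-1)/2) z^n / (q; q)_n`. -/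
noncomputable def qTerm (q b z : ℂ) (n : ℕ) : ℂ :=
  qPoch b q n * q ^ (n * (n - 1) / 2) * z ^ n / qPoch q q n

/-- The sum `∑ (b; q)_n q^(n(n-1)/2) z^n / (q; q)_n`. -/
noncomputable def qSeries (q b z : ℂ) : ℂ := ∑' n, qTerm q b z n

theorem exists_bound_qPoch {q : ℂ} (hq : ‖q‖ < 1) :
    ∃ C, ∀ b : ℂ, ‖b‖ ≤ 1 → ∀ n, ‖qPoch b q n‖ ≤ C := by
  refine ⟨Real.exp (∑' k, ‖q‖ ^ k), fun b hb n => ?_⟩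
  have hs := summable_geometric_of_lt_one (norm_nonneg q) hq
  calc ‖qPoch b q n‖ ≤ ∏ k ∈ Finset.range n, (1 + ‖q‖ ^ k) := by
        rw [qPoch, norm_prod]
        refine Finset.prod_le_prod (fun _ _ => norm_nonneg _) fun k _ => ?_
        refine (norm_sub_le _ _).trans ?_
        rw [norm_one, norm_mul, norm_pow]
        gcongr
        exact mul_le_of_le_one_left (by positivity) hb
    _ ≤ Real.exp (∑ k ∈ Finset.range n, ‖q‖ ^ k) :=
        Real.prod_one_add_le_exp_sum _ fun k => by positivity
    _ ≤ _ := Real.exp_le_exp.mpr (hs.sum_le_tsum _ fun k _ => by positivity)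

theorem exists_bound_inv_qPoch {q : ℂ} (hq : ‖q‖ < 1) : ∃ C, ∀ n, ‖(qPoch q q n)⁻¹‖ ≤ C := by
  obtain ⟨C, hC⟩ := ((tendsto_qPoch q hq).inv₀ (qPochInf_ne_zero hq hq)).norm.bddAbove_range
  exact ⟨C, fun n => hC ⟨n, rfl⟩⟩

theorem summable_pow_triangle {r : ℝ} (h0 : 0 ≤ r) (h1 : r < 1) :
    Summable fun n : ℕ => r ^ (n * (n - 1) / 2) := by
  -- After the shift the exponent is `n(n-1)/2 + n ≥ n`, so a geometric series dominates.
  rw [← summable_nat_add_iff 1]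
  refine (summable_geometric_of_lt_one h0 h1).of_nonneg_of_le (fun _ => by positivity) fun n => ?_
  refine pow_le_pow_of_le_one h0 h1.le ?_
  rw [Nat.triangle_succ]
  omega

/-- One bound uniform in `b` and `z` permits dominated convergence when both parameters vary. -/
theorem exists_summable_bound_qTerm {q : ℂ} (hq : ‖q‖ < 1) :
    ∃ g : ℕ → ℝ, Summable g ∧ ∀ b z : ℂ, ‖b‖ ≤ 1 → ‖z‖ ≤ 1 → ∀ n, ‖qTerm q b z n‖ ≤ g n := by
  obtain ⟨C, hC⟩ := exists_bound_qPoch hq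
  obtain ⟨D, hD⟩ := exists_bound_inv_qPoch hq
  have hC0 : 0 ≤ C := (norm_nonneg _).trans (hC 0 (by simp) 0)
  refine ⟨fun n => C * ‖q‖ ^ (n * (n - 1) / 2) * 1 * D,
    (((summable_pow_triangle (norm_nonneg q) hq).mul_left C).mul_right 1).mul_right D,
    fun b z hb hz n => ?_⟩
  rw [qTerm, div_eq_mul_inv, norm_mul, norm_mul, norm_mul, norm_pow, norm_pow]
  beta_reduce
  gcongr
  · exact hC b hb n
  · exact pow_le_one₀ (norm_nonneg _) hz
  · exact hD n

theorem summable_qTerm {q b z : ℂ} (hq : ‖q‖ < 1) (hb : ‖b‖ ≤ 1) (hz : ‖z‖ ≤ 1) :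
    Summable (qTerm q b z) := by
  obtain ⟨g, hg, h⟩ := exists_summable_bound_qTerm hq
  exact hg.of_norm_bounded (h b z hb hz)

theorem tendsto_qSeries {q : ℂ} (hq : ‖q‖ < 1) {u v : ℕ → ℂ} {b z : ℂ}
    (hu : ∀ k, ‖u k‖ ≤ 1) (hv : ∀ k, ‖v k‖ ≤ 1)
    (hub : Tendsto u atTop (𝓝 b)) (hvz : Tendsto v atTop (𝓝 z)) :
    Tendsto (fun k => qSeries q (u k) (v k)) atTop (𝓝 (qSeries q b z)) := by
  obtain ⟨g, hg, h⟩ := exists_summable_bound_qTerm hq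
  refine tendsto_tsum_of_dominated_convergence hg (fun n => ?_)
    (Eventually.of_forall fun k n => h _ _ (hu k) (hv k) n)
  have hp : Tendsto (fun k => qPoch (u k) q n) atTop (𝓝 (qPoch b q n)) :=
    tendsto_finsetProd _ fun i _ => (hub.mul_const _).const_sub 1
  exact ((hp.mul_const _).mul (hvz.pow n)).div_const _

theorem qTerm_zero (q b z : ℂ) : qTerm q b z 0 = 1 := by simp [qTerm, qPoch_zero]

/-- Dilating the variable `z` of the general term by `q`. -/
theorem qTerm_mul (q b z : ℂ) (n : ℕ) : qTerm q b (z * q) n = qTerm q b z n * q ^ n := by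
  unfold qTerm; ring

/-- The fundamental contiguity relation of the general term. -/
theorem qTerm_succ {q : ℂ} (hq : ‖q‖ < 1) (b z : ℂ) (n : ℕ) :
    qTerm q b z (n + 1) * (1 - q ^ (n + 1)) = z * q ^ n * (1 - b * q ^ n) * qTerm q b z n := by
  have h1 := qPoch_self_ne_zero hq n
  have h2 : 1 - q ^ (n + 1) ≠ 0 := by
    simpa [pow_succ'] using one_sub_mul_pow_ne_zero hq hq n
  unfold qTerm
  rw [Nat.triangle_succ, qPoch_succ, qPoch_succ, show q * q ^ n = q ^ (n + 1) by ring]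
  field_simp
  ring

/-- Shifting the parameter `b` of the general term. -/
theorem qTerm_shift (q b z : ℂ) (n : ℕ) :
    (1 - b) * qTerm q (b * q) z n = (1 - b * q ^ n) * qTerm q b z n := by
  have h : (1 - b) * qPoch (b * q) q n = qPoch b q n * (1 - b * q ^ n) := by
    rw [← qPoch_succ', qPoch_succ]
  unfold qTerm
  linear_combination (q ^ (n * (n - 1) / 2) * z ^ n / qPoch q q n) * h

theorem norm_mul_le_one {a b : ℂ} (ha : ‖a‖ ≤ 1) (hb : ‖b‖ ≤ 1) : ‖a * b‖ ≤ 1 := by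
  rw [norm_mul]; exact mul_le_one₀ ha (norm_nonneg _) hb

/-- The `q`-difference equation of the series in the variable `z`. -/
theorem qSeries_sub {q b z : ℂ} (hq : ‖q‖ < 1) (hb : ‖b‖ ≤ 1) (hz : ‖z‖ ≤ 1) :
    qSeries q b z - qSeries q b (z * q) =
      z * (qSeries q b (z * q) - b * qSeries q b (z * q * q)) := by
  have hzq := norm_mul_le_one hz hq.le
  have h0 := summable_qTerm hq hb hz
  have h1 := summable_qTerm hq hb hzq
  have h2 := summable_qTerm hq hb (norm_mul_le_one hzq hq.le)
  unfold qSeries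
  rw [← h0.tsum_sub h1, (h0.sub h1).tsum_eq_zero_add, ← tsum_mul_left, ← h1.tsum_sub
    (h2.mul_left b), ← tsum_mul_left, qTerm_zero, qTerm_zero, sub_self, zero_add]
  refine tsum_congr fun n => ?_
  rw [qTerm_mul q b (z * q), qTerm_mul q b z (n + 1), qTerm_mul q b z n]
  linear_combination qTerm_succ hq b z n

/-- Euler's identity `∑ q^(n(n-1)/2) z^n / (q; q)_n = (-z; q)_∞`. -/
theorem qSeries_zero_left {q z : ℂ} (hq : ‖q‖ < 1) (hz : ‖z‖ ≤ 1) :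
    qSeries q 0 z = qPochInf (-z) q := by
  have hv : ∀ k : ℕ, ‖z * q ^ k‖ ≤ 1 := fun k =>
    norm_mul_le_one hz (by rw [norm_pow]; exact pow_le_one₀ (norm_nonneg _) hq.le)
  -- For `b = 0` the `q`-difference equation has order one: each dilation of `z` extracts a factor
  -- `1 + z q^k`.
  have hstep : ∀ k, qSeries q 0 z = qPoch (-z) q k * qSeries q 0 (z * q ^ k) := by
    intro k
    induction k with
    | zero => simp [qPoch_zero]
    | succ k ih =>
      have := qSeries_sub (b := 0) hq (by simp) (hv k)
      rw [ih, qPoch_succ, pow_succ, ← mul_assoc z]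
      linear_combination qPoch (-z) q k * this
  have hlim : Tendsto (fun k : ℕ => z * q ^ k) atTop (𝓝 0) := by
    simpa using (tendsto_pow_atTop_nhds_zero_of_norm_lt_one hq).const_mul z
  have h1 := (tendsto_qPoch (-z) hq).mul
    (tendsto_qSeries hq (u := fun _ => 0) (by simp) hv tendsto_const_nhds hlim)
  have h2 : qSeries q 0 0 = 1 := by
    rw [qSeries, tsum_eq_single 0 fun n hn => by simp [qTerm, hn], qTerm_zero]
  rw [h2, mul_one] at h1
  exact tendsto_nhds_unique (tendsto_const_nhds.congr hstep) h1

/-- The `q`-difference equation behind Lebesgue's identity. -/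
theorem qSeries_self_sub {q b : ℂ} (hq : ‖q‖ < 1) (hb : ‖b‖ ≤ 1) :
    qSeries q b q = (1 - b * q) * qSeries q (b * q ^ 2) q := by
  have hbq := norm_mul_le_one hb hq.le
  have hbq2 := norm_mul_le_one hbq hq.le
  have h0 := summable_qTerm hq hb hq.le
  have h1 := summable_qTerm hq hbq hq.le
  have h2 := summable_qTerm hq hbq (norm_mul_le_one hq.le hq.le)
  -- Since `(b)_(n+1) - (bq)_(n+1) = -b (1 - q^(n+1)) (bq)_n`, the last factor of `(q; q)_(n+1)`
  -- cancels.
  have hA : qSeries q b q - qSeries q (b * q) q = -(b * q) * qSeries q (b * q) (q * q) := by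
    unfold qSeries
    rw [← h0.tsum_sub h1, (h0.sub h1).tsum_eq_zero_add, ← tsum_mul_left, qTerm_zero, qTerm_zero,
      sub_self, zero_add]
    refine tsum_congr fun n => ?_
    have hn := qPoch_self_ne_zero hq n
    have hn' : 1 - q ^ (n + 1) ≠ 0 := by
      simpa [pow_succ'] using one_sub_mul_pow_ne_zero hq hq n
    unfold qTerm
    rw [Nat.triangle_succ, qPoch_succ' b, qPoch_succ (b * q), qPoch_succ q q,
      show q * q ^ n = q ^ (n + 1) by ring]
    field_simp
    ring
  have hB : qSeries q (b * q) q - b * q * qSeries q (b * q) (q * q) =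
      (1 - b * q) * qSeries q (b * q ^ 2) q := by
    rw [show b * q ^ 2 = b * q * q by ring]
    unfold qSeries
    rw [← tsum_mul_left, ← tsum_mul_left, ← h1.tsum_sub (h2.mul_left _)]
    refine tsum_congr fun n => ?_
    rw [qTerm_shift, qTerm_mul]
    ring
  linear_combination hA + hB

/-- Lebesgue's identity. -/
theorem qSeries_self {q b : ℂ} (hq : ‖q‖ < 1) (hb : ‖b‖ ≤ 1) :
    qSeries q b q = qPochInf (b * q) (q ^ 2) * qPochInf (-q) q := by
  have hq2 := norm_sq_lt_one hq
  have hu : ∀ k : ℕ, ‖b * (q ^ 2) ^ k‖ ≤ 1 := fun k =>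
    norm_mul_le_one hb (by rw [norm_pow]; exact pow_le_one₀ (norm_nonneg _) hq2.le)
  -- Here `b` is dilated by `q^2` while `z = q` stays fixed; the limit `b = 0` is Euler's case.
  have hstep : ∀ k, qSeries q b q =
      qPoch (b * q) (q ^ 2) k * qSeries q (b * (q ^ 2) ^ k) q := by
    intro k
    induction k with
    | zero => simp [qPoch_zero]
    | succ k ih =>
      rw [ih, qPoch_succ, qSeries_self_sub hq (hu k), pow_succ (q ^ 2) k]
      ring_nf
  have hlim : Tendsto (fun k : ℕ => b * (q ^ 2) ^ k) atTop (𝓝 0) := by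
    simpa using (tendsto_pow_atTop_nhds_zero_of_norm_lt_one hq2).const_mul b
  have h1 := (tendsto_qPoch (b * q) hq2).mul
    (tendsto_qSeries hq hu (v := fun _ => q) (fun _ => hq.le) hlim tendsto_const_nhds)
  rw [qSeries_zero_left hq hq.le] at h1
  exact tendsto_nhds_unique (tendsto_const_nhds.congr hstep) h1

/-! ### Product evaluations for `m = 1` and `m = 0`. -/

theorem qPochInf_quotient_four {q : ℂ} (hq : ‖q‖ < 1) :
    qPochInf (-q * q) (q ^ 2) * qPochInf (-q) q = qPochInf (q ^ 4) (q ^ 4) / qPochInf q q := by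
  have hq2 := norm_sq_lt_one hq
  rw [eq_div_iff (qPochInf_ne_zero hq hq), show q ^ 4 = (q ^ 2) ^ 2 by ring,
    ← qPochInf_mul_neg (q ^ 2) hq2, ← qPochInf_mul_neg q hq, show -q * q = -q ^ 2 by ring]
  ring

/-- Euler's theorem on partitions into odd and into distinct parts: both products, times `(q^2;
q^2)_∞`, give `(q^2; q^2)_∞`. -/
theorem qPochInf_odd_mul_neg {q : ℂ} (hq : ‖q‖ < 1) :
    qPochInf q (q ^ 2) * qPochInf (-q) q = 1 := by
  have hq2 := norm_sq_lt_one hq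
  have h := qPochInf_mul_neg q hq
  rw [← qPochInf_even_mul_odd q hq, show q * q = q ^ 2 by ring] at h
  exact mul_right_cancel₀ (qPochInf_ne_zero hq2 hq2) (by linear_combination h)

theorem qPochInf_quotient_odd {q : ℂ} (hq : ‖q‖ < 1) :
    qPochInf (-1 * q) (q ^ 2) * qPochInf (-q) q =
      qPochInf (-q) (q ^ 2) / qPochInf q (q ^ 2) := by
  rw [eq_div_iff (qPochInf_ne_zero hq (norm_sq_lt_one hq)), neg_one_mul]
  linear_combination qPochInf (-q) (q ^ 2) * qPochInf_odd_mul_neg hq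

theorem qSeries_neg_self_self {q : ℂ} (hq : ‖q‖ < 1) :
    qSeries q (-q) q = qPochInf (q ^ 4) (q ^ 4) / qPochInf q q := by
  rw [qSeries_self hq (by simpa using hq.le), qPochInf_quotient_four hq]

theorem qSeries_neg_self_one {q : ℂ} (hq : ‖q‖ < 1) :
    qSeries q (-q) 1 = qPochInf (q ^ 4) (q ^ 4) / qPochInf q q +
      qPochInf (-q) (q ^ 2) / qPochInf q (q ^ 2) := by
  have hb : ‖-q‖ ≤ 1 := by simpa using hq.le
  have h0 := summable_qTerm (z := 1) hq hb (by simp)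
  have h1 := summable_qTerm (b := -1) hq (by simp) hq.le
  rw [← qSeries_neg_self_self hq, ← qPochInf_quotient_odd hq, ← qSeries_self hq (by simp),
    -- The goal is now `S(-q, 1) - S(-1, q) = S(-q, q)`, termwise from `(-q)_(n+1) - q^(n+1)
    -- (-1)_(n+1) = (1 - q^(n+1)) (-q)_n`.
    ← sub_eq_iff_eq_add]
  unfold qSeries
  rw [← h0.tsum_sub h1, (h0.sub h1).tsum_eq_zero_add, qTerm_zero, qTerm_zero, sub_self, zero_add]
  refine tsum_congr fun n => ?_
  have hn := qPoch_self_ne_zero hq n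
  have hn' : 1 - q ^ (n + 1) ≠ 0 := by
    simpa [pow_succ'] using one_sub_mul_pow_ne_zero hq hq n
  unfold qTerm
  rw [Nat.triangle_succ, qPoch_succ' (-1), qPoch_succ (-q), qPoch_succ q q,
    show q * q ^ n = q ^ (n + 1) by ring, neg_one_mul]
  field_simp
  ring

theorem qSeries_recurrence {q : ℂ} (hq : ‖q‖ < 1) (m : ℕ) :
    q ^ (m + 1) * qSeries q (-q) (q ^ (m + 2)) =
      qSeries q (-q) (q ^ m) - (1 + q ^ m) * qSeries q (-q) (q ^ (m + 1)) := by
  have h := qSeries_sub (b := -q) (z := q ^ m) hq (by simpa using hq.le)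
    (by rw [norm_pow]; exact pow_le_one₀ (norm_nonneg _) hq.le)
  rw [show q ^ m * q * q = q ^ (m + 2) by ring, show q ^ m * q = q ^ (m + 1) by ring] at h
  linear_combination -h

/-! ### Gaussian polynomials and the `q`-Pascal rules. -/

theorem gaussPoly_eq_zero (q : ℂ) {n k : ℤ} (h : n < k) : gaussPoly q n k = 0 :=
  if_neg fun h' => by omega

theorem gaussPoly_natCast_add (q : ℂ) (k j : ℕ) :
    gaussPoly q ((k : ℤ) + j) k = qPoch q q (k + j) / (qPoch q q k * qPoch q q j) := by
  rw [gaussPoly, if_pos (by omega)]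
  congr 3
  all_goals omega

theorem gaussPoly_zero_right {q : ℂ} (hq : ‖q‖ < 1) (n : ℕ) : gaussPoly q n 0 = 1 := by
  have h := gaussPoly_natCast_add q 0 n
  have hn := qPoch_self_ne_zero hq n
  rw [Nat.cast_zero, zero_add, zero_add, qPoch_zero, one_mul, div_self hn] at h
  exact h

/-- The `q`-Pascal rule with the power on the entry `n - 1` over `k - 1`. -/
theorem gaussPoly_succ_sub {q : ℂ} (hq : ‖q‖ < 1) (k j : ℕ) :
    gaussPoly q ((k : ℤ) + j + 1) (k + 1) =
      gaussPoly q ((k : ℤ) + j) (k + 1) + q ^ j * gaussPoly q ((k : ℤ) + j) k := by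
  have h1 := gaussPoly_natCast_add q (k + 1) j
  rw [show ((k + 1 : ℕ) : ℤ) + j = (k : ℤ) + j + 1 by push_cast; ring, Nat.cast_succ] at h1
  rw [h1, gaussPoly_natCast_add]
  have hne := fun n => qPoch_self_ne_zero hq n
  have hs : ∀ n : ℕ, 1 - q * q ^ n ≠ 0 := one_sub_mul_pow_ne_zero hq hq
  rcases j with _ | j
  · rw [gaussPoly_eq_zero q (by push_cast; omega)]
    have := hne k
    have := hne (k + 1)
    simp only [qPoch_zero, Nat.add_zero]
    field_simp
    ring
  · have h2 := gaussPoly_natCast_add q (k + 1) j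
    rw [show ((k + 1 : ℕ) : ℤ) + j = (k : ℤ) + (j + 1 : ℕ) by push_cast; ring,
      Nat.cast_succ k] at h2
    rw [h2, show k + 1 + (j + 1) = k + j + 1 + 1 by ring, show k + 1 + j = k + j + 1 by ring,
      show k + (j + 1) = k + j + 1 by ring]
    have a1 := hne k
    have a2 := hne j
    have a3 := hs k
    have a4 := hs j
    rw [qPoch_succ q q (k + j + 1), qPoch_succ q q k, qPoch_succ q q j]
    field_simp
    ring

/-- The `q`-Pascal rule with the power on the entry `n - 1` over `k`. -/
theorem gaussPoly_succ_pow {q : ℂ} (hq : ‖q‖ < 1) (n k : ℕ) :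
    gaussPoly q ((n : ℤ) + 1) (k + 1) =
      q ^ (k + 1) * gaussPoly q n (k + 1) + gaussPoly q n k := by
  rcases lt_or_ge n k with h | h
  · rw [gaussPoly_eq_zero q (by omega), gaussPoly_eq_zero q (by omega),
      gaussPoly_eq_zero q (by omega), mul_zero, zero_add]
  obtain ⟨j, rfl⟩ := Nat.exists_eq_add_of_le h
  have h1 := gaussPoly_natCast_add q (k + 1) j
  rw [show ((k + 1 : ℕ) : ℤ) + j = ((k + j : ℕ) : ℤ) + 1 by push_cast; ring, Nat.cast_succ] at h1
  have h3 := gaussPoly_natCast_add q k j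
  rw [← Nat.cast_add] at h3
  rw [h1, h3]
  have hne := fun n => qPoch_self_ne_zero hq n
  have hs : ∀ n : ℕ, 1 - q * q ^ n ≠ 0 := one_sub_mul_pow_ne_zero hq hq
  rcases j with _ | j
  · rw [gaussPoly_eq_zero q (by push_cast; omega)]
    have := hne k
    have := hne (k + 1)
    simp only [qPoch_zero, Nat.add_zero]
    field_simp
    ring
  · have h2 := gaussPoly_natCast_add q (k + 1) j
    rw [show ((k + 1 : ℕ) : ℤ) + j = ((k + (j + 1) : ℕ) : ℤ) by push_cast; ring,
      Nat.cast_succ k] at h2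
    rw [h2, show k + 1 + (j + 1) = k + j + 1 + 1 by ring, show k + 1 + j = k + j + 1 by ring,
      show k + (j + 1) = k + j + 1 by ring]
    have a1 := hne k
    have a2 := hne j
    have a3 := hs k
    have a4 := hs j
    rw [qPoch_succ q q (k + j + 1), qPoch_succ q q k, qPoch_succ q q j]
    field_simp
    ring

/-! ### Recurrences for the double sums. -/

/-- The common shape of `aTerm` (`c = 0`, `K = m - 1`) and `bTerm` (`c = 1`, `K = m - 2`). -/
noncomputable def gaussTerm (q : ℂ) (c : ℕ) (K : ℤ) (n l : ℕ) : ℂ :=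
  q ^ (n * (n - 1) / 2 + c * n + l * (l + 1) / 2) * gaussPoly q (K - l) n * gaussPoly q n l

theorem aTerm_eq_gaussTerm (q : ℂ) (m n l : ℕ) :
    aTerm q m n l = gaussTerm q 0 ((m : ℤ) - 1) n l := by
  simp [aTerm, gaussTerm]

theorem bTerm_eq_gaussTerm (q : ℂ) (m n l : ℕ) :
    bTerm q m n l = gaussTerm q 1 ((m : ℤ) - 2) n l := by
  have h : n * (n + 1) / 2 = n * (n - 1) / 2 + n := by
    rw [← Nat.triangle_succ, Nat.add_sub_cancel, mul_comm]
  simp [bTerm, gaussTerm, h]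

theorem gaussTerm_eq_zero (q : ℂ) (c : ℕ) {K : ℤ} {n l : ℕ} (h : K < n ∨ K < l) :
    gaussTerm q c K n l = 0 := by
  rw [gaussTerm, gaussPoly_eq_zero q (n := K - l) (by omega), mul_zero, zero_mul]

theorem gaussTerm_zero_left {q : ℂ} (hq : ‖q‖ < 1) (c K l : ℕ) :
    gaussTerm q c K 0 l = if l = 0 then 1 else 0 := by
  split_ifs with h
  · subst h
    have h0 := gaussPoly_zero_right hq 0
    have hK := gaussPoly_zero_right hq K
    rw [Nat.cast_zero] at h0
    simp [gaussTerm, h0, hK]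
  · rw [gaussTerm, gaussPoly_eq_zero q (n := ((0 : ℕ) : ℤ)) (by push_cast; omega), mul_zero]

/-- The difference in `K` of the first Gaussian polynomial, with its power of `q` absorbed. -/
theorem gaussPoly_sub {q : ℂ} (hq : ‖q‖ < 1) (K n l : ℕ) :
    q ^ (n + l) * (gaussPoly q ((K : ℤ) + 1 - l) (n + 1) - gaussPoly q ((K : ℤ) - l) (n + 1)) =
      q ^ K * gaussPoly q ((K : ℤ) - l) n := by
  rcases lt_or_ge K (n + l) with h | h
  · rw [gaussPoly_eq_zero q (by omega), gaussPoly_eq_zero q (by omega),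
      gaussPoly_eq_zero q (n := (K : ℤ) - l) (k := n) (by omega)]
    ring
  -- The Pascal factor is `q^j` with `j = K - n - l`; the prefactor `q^(n+l)` turns it into `q^K`,
  -- free of `n` and `l`.
  obtain ⟨j, rfl⟩ := Nat.exists_eq_add_of_le h
  have := gaussPoly_succ_sub hq n j
  rw [show ((n + l + j : ℕ) : ℤ) + 1 - l = (n : ℤ) + j + 1 by push_cast; ring,
    show ((n + l + j : ℕ) : ℤ) - l = (n : ℤ) + j by push_cast; ring, this]
  ring

theorem gaussTerm_sub_zero {q : ℂ} (hq : ‖q‖ < 1) (c K n : ℕ) :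
    gaussTerm q c ((K : ℤ) + 1) (n + 1) 0 - gaussTerm q c K (n + 1) 0 =
      q ^ (K + c) * gaussTerm q c K n 0 := by
  have h := gaussPoly_sub hq K n 0
  have h1 := gaussPoly_zero_right hq n
  have h2 := gaussPoly_zero_right hq (n + 1)
  unfold gaussTerm
  rw [Nat.triangle_succ]
  simp only [Nat.cast_zero, sub_zero, add_zero, Nat.cast_add, Nat.cast_one] at h h1 h2 ⊢
  rw [h1, h2]
  linear_combination q ^ (n * (n - 1) / 2 + c * n + c) * h

/-- `gaussPoly_sub` handles the first Gaussian factor and `q`-Pascal splits the second; the piece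
with index `l` belongs to `K - 1` because `K - (l + 1) = (K - 1) - l`. -/
theorem gaussTerm_sub_succ {q : ℂ} (hq : ‖q‖ < 1) (c K n l : ℕ) :
    gaussTerm q c ((K : ℤ) + 1) (n + 1) (l + 1) - gaussTerm q c K (n + 1) (l + 1) =
      q ^ (K + c) * (gaussTerm q c K n (l + 1) + gaussTerm q c ((K : ℤ) - 1) n l) := by
  have h := gaussPoly_sub hq K n (l + 1)
  have h1 := gaussPoly_succ_pow hq n l
  have ht : (l + 1) * (l + 1 + 1) / 2 = l * (l + 1) / 2 + (l + 1) := by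
    have := Nat.triangle_succ (l + 1)
    rw [Nat.add_sub_cancel, Nat.add_sub_cancel] at this
    rw [mul_comm, this, mul_comm l]
  unfold gaussTerm
  rw [Nat.triangle_succ, ht, show (K : ℤ) - 1 - l = K - (l + 1 : ℕ) by push_cast; ring]
  push_cast at h h1 ⊢
  rw [h1]
  linear_combination (q ^ (n * (n - 1) / 2 + c * n + c + l * (l + 1) / 2) *
    (q ^ (l + 1) * gaussPoly q n (l + 1) + gaussPoly q n l)) * h

/-- The double sum of `gaussTerm` over a square. -/
noncomputable def gaussSquareSum (q : ℂ) (c : ℕ) (K : ℤ) (R : ℕ) : ℂ :=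
  ∑ n ∈ Finset.range R, ∑ l ∈ Finset.range R, gaussTerm q c K n l

/-- This lets the sums for `K + 1`, `K` and `K - 1` share one square. -/
theorem gaussSquareSum_eq_of_le (q : ℂ) (c : ℕ) {K : ℤ} {R S : ℕ} (hK : K < R) (hRS : R ≤ S) :
    gaussSquareSum q c K S = gaussSquareSum q c K R := by
  have hsub := Finset.range_mono hRS
  unfold gaussSquareSum
  rw [← Finset.sum_subset hsub]
  · refine Finset.sum_congr rfl fun n _ => (Finset.sum_subset hsub fun l _ hl => ?_).symm
    exact gaussTerm_eq_zero q c (.inr (by simp at hl; omega))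
  · intro n _ hn
    exact Finset.sum_eq_zero fun l _ => gaussTerm_eq_zero q c (.inl (by simp at hn; omega))

theorem gaussSquareSum_recurrence {q : ℂ} (hq : ‖q‖ < 1) (c K : ℕ) {R : ℕ} (hR : K < R) :
    gaussSquareSum q c ((K : ℤ) + 1) (R + 1) - gaussSquareSum q c K (R + 1) =
      q ^ (K + c) * (gaussSquareSum q c K (R + 1) + gaussSquareSum q c ((K : ℤ) - 1) (R + 1)) := by
  -- Row `n = 0` does not depend on `K`; every other row difference reduces to row `n - 1`.
  have hrow0 : ∑ l ∈ Finset.range (R + 1), gaussTerm q c ((K : ℤ) + 1) 0 l -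
      ∑ l ∈ Finset.range (R + 1), gaussTerm q c K 0 l = 0 := by
    rw [← Finset.sum_sub_distrib]
    refine Finset.sum_eq_zero fun l _ => ?_
    have := gaussTerm_zero_left hq c (K + 1) l
    rw [Nat.cast_succ] at this
    rw [this, gaussTerm_zero_left hq, sub_self]
  have hrow : ∀ n, ∑ l ∈ Finset.range (R + 1), gaussTerm q c ((K : ℤ) + 1) (n + 1) l -
      ∑ l ∈ Finset.range (R + 1), gaussTerm q c K (n + 1) l =
      q ^ (K + c) * (∑ l ∈ Finset.range (R + 1), gaussTerm q c K n l +
        ∑ l ∈ Finset.range R, gaussTerm q c ((K : ℤ) - 1) n l) := by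
    intro n
    rw [← Finset.sum_sub_distrib, Finset.sum_range_succ', gaussTerm_sub_zero hq,
      Finset.sum_congr rfl fun l _ => gaussTerm_sub_succ hq c K n l, ← Finset.mul_sum,
      Finset.sum_add_distrib, Finset.sum_range_succ' (fun l => gaussTerm q c K n l)]
    ring
  have hK : gaussSquareSum q c K (R + 1) =
      ∑ n ∈ Finset.range R, ∑ l ∈ Finset.range (R + 1), gaussTerm q c K n l := by
    rw [gaussSquareSum, Finset.sum_range_succ, Finset.sum_eq_zero (s := Finset.range (R + 1))
      (f := fun l => gaussTerm q c K R l) fun l _ => gaussTerm_eq_zero q c (.inl (by omega)),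
      add_zero]
  have hK' : gaussSquareSum q c ((K : ℤ) - 1) (R + 1) =
      ∑ n ∈ Finset.range R, ∑ l ∈ Finset.range R, gaussTerm q c ((K : ℤ) - 1) n l :=
    gaussSquareSum_eq_of_le q c (by omega) R.le_succ
  have hL : gaussSquareSum q c ((K : ℤ) + 1) (R + 1) - gaussSquareSum q c K (R + 1) =
      ∑ n ∈ Finset.range R,
        (∑ l ∈ Finset.range (R + 1), gaussTerm q c ((K : ℤ) + 1) (n + 1) l -
          ∑ l ∈ Finset.range (R + 1), gaussTerm q c K (n + 1) l) := by
    unfold gaussSquareSum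
    rw [Finset.sum_sub_distrib,
      Finset.sum_range_succ' fun n =>
        ∑ l ∈ Finset.range (R + 1), gaussTerm q c ((K : ℤ) + 1) n l,
      Finset.sum_range_succ' fun n => ∑ l ∈ Finset.range (R + 1), gaussTerm q c K n l]
    linear_combination hrow0
  rw [hL, hK, hK', ← Finset.sum_add_distrib, Finset.mul_sum]
  exact Finset.sum_congr rfl fun n _ => hrow n

theorem aSum_eq_gaussSquareSum (q : ℂ) {m R : ℕ} (h : m ≤ R) :
    aSum q m = gaussSquareSum q 0 ((m : ℤ) - 1) R := by
  rw [gaussSquareSum_eq_of_le q 0 (by omega) h, aSum]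
  split_ifs with hm
  · simp [hm, gaussSquareSum]
  · simp_rw [aTerm_eq_gaussTerm]; rfl

theorem bSum_eq_gaussSquareSum (q : ℂ) {m R : ℕ} (hm : m ≠ 0) (h : m ≤ R) :
    bSum q m = gaussSquareSum q 1 ((m : ℤ) - 2) R := by
  rw [gaussSquareSum_eq_of_le q 1 (by omega) h, bSum, if_neg hm]
  simp_rw [bTerm_eq_gaussTerm]; rfl

theorem aSum_recurrence {q : ℂ} (hq : ‖q‖ < 1) (m : ℕ) :
    aSum q (m + 2) = (1 + q ^ m) * aSum q (m + 1) + q ^ m * aSum q m := by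
  have h := gaussSquareSum_recurrence hq 0 m (R := m + 1) m.lt_succ_self
  rw [aSum_eq_gaussSquareSum q (R := m + 1 + 1) le_rfl, aSum_eq_gaussSquareSum q (R := m + 1 + 1) (by omega),
    aSum_eq_gaussSquareSum q (m := m) (R := m + 1 + 1) (by omega),
    show ((m + 2 : ℕ) : ℤ) - 1 = m + 1 by push_cast; ring,
    show ((m + 1 : ℕ) : ℤ) - 1 = m by push_cast; ring]
  linear_combination h

theorem bSum_zero (q : ℂ) : bSum q 0 = 1 := if_pos rfl

theorem bSum_one (q : ℂ) : bSum q 1 = 0 := by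
  rw [bSum_eq_gaussSquareSum q one_ne_zero le_rfl]
  exact Finset.sum_eq_zero fun n _ => Finset.sum_eq_zero fun l _ =>
    gaussTerm_eq_zero q 1 (.inl (by push_cast; omega))

theorem gaussSquareSum_zero {q : ℂ} (hq : ‖q‖ < 1) (c : ℕ) {R : ℕ} (hR : 1 ≤ R) :
    gaussSquareSum q c 0 R = 1 := by
  have h := gaussTerm_zero_left hq c 0 0
  rw [Nat.cast_zero, if_pos rfl] at h
  rw [gaussSquareSum_eq_of_le q c (by norm_num) hR]
  simp [gaussSquareSum, h]

theorem aSum_zero (q : ℂ) : aSum q 0 = 0 := if_pos rfl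

theorem aSum_one {q : ℂ} (hq : ‖q‖ < 1) : aSum q 1 = 1 := by
  rw [aSum_eq_gaussSquareSum q le_rfl]
  simpa using gaussSquareSum_zero hq 0 le_rfl

theorem bSum_recurrence {q : ℂ} (hq : ‖q‖ < 1) (m : ℕ) :
    bSum q (m + 2) = (1 + q ^ m) * bSum q (m + 1) + q ^ m * bSum q m := by
  -- The value `b_0 = 1` is a convention, not a value of the double sum, so `m = 0` is separate.
  rcases m with _ | m
  · rw [bSum_zero, bSum_one, bSum_eq_gaussSquareSum q (by omega) le_rfl]
    simpa using gaussSquareSum_zero hq 1 (R := 2) (by omega)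
  have h := gaussSquareSum_recurrence hq 1 m (R := m + 2) (by omega)
  rw [bSum_eq_gaussSquareSum q (R := m + 2 + 1) (by omega) (by omega),
    bSum_eq_gaussSquareSum q (m := m + 1 + 1) (R := m + 2 + 1) (by omega) (by omega),
    bSum_eq_gaussSquareSum q (m := m + 1) (R := m + 2 + 1) (by omega) (by omega),
    show ((m + 1 + 2 : ℕ) : ℤ) - 2 = m + 1 by push_cast; ring,
    show ((m + 1 + 1 : ℕ) : ℤ) - 2 = m by push_cast; ring,
    show ((m + 1 : ℕ) : ℤ) - 2 = m - 1 by push_cast; ring]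
  linear_combination h

/-- The sum of the series, up to the sign and the power of `q` that clear denominators. -/
theorem pow_triangle_mul_qSeries {q : ℂ} (hq : ‖q‖ < 1) (m : ℕ) :
    (-1) ^ (m + 1) * q ^ (m * (m - 1) / 2) * qSeries q (-q) (q ^ m) =
      (aSum q m - bSum q m) * (qPochInf (q ^ 4) (q ^ 4) / qPochInf q q) -
        bSum q m * (qPochInf (-q) (q ^ 2) / qPochInf q (q ^ 2)) := by
  induction m using Nat.twoStepInduction with
  | zero =>
    rw [aSum_zero, bSum_zero, pow_zero q, qSeries_neg_self_one hq]
    simp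
    ring
  | one =>
    rw [aSum_one hq, bSum_one, pow_one q, qSeries_neg_self_self hq]
    simp
  | more m h0 h1 =>
    have h := qSeries_recurrence hq m
    rw [aSum_recurrence hq, bSum_recurrence hq]
    rw [Nat.triangle_succ] at h1
    rw [show m + 2 = m + 1 + 1 by ring, Nat.triangle_succ (m + 1), Nat.triangle_succ m,
      show m + 1 + 1 = m + 2 by ring]
    linear_combination (1 + q ^ m) * h1 + q ^ m * h0 -
      (-1) ^ m * q ^ (m * (m - 1) / 2 + m) * h

theorem corollary2p5 (q : ℂ) (hq : ‖q‖ < 1) (m : ℕ) (hq0 : 2 ≤ m → q ≠ 0) :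
    HasSum
      (fun n : ℕ => qPoch (-q) q n * q ^ (n * (n - 1) / 2 + m * n) / qPoch q q n)
      ((-1 : ℂ) ^ ((m : ℤ) - 1) / q ^ (m * (m - 1) / 2) *
        ((aSum q m - bSum q m) * (qPochInf (q ^ 4) (q ^ 4) / qPochInf q q) -
          bSum q m * (qPochInf (-q) (q ^ 2) / qPochInf q (q ^ 2)))) := by
  have hs := (summable_qTerm (b := -q) (z := q ^ m) hq (by simpa using hq.le)
    (by rw [norm_pow]; exact pow_le_one₀ (norm_nonneg _) hq.le)).hasSum
  have hne : q ^ (m * (m - 1) / 2) ≠ 0 := by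
    -- For `m < 2` the exponent is `0`, so `q = 0` is harmless.
    rcases lt_or_ge m 2 with h | h
    · interval_cases m <;> simp
    · exact pow_ne_zero _ (hq0 h)
  have hsign : (-1 : ℂ) ^ ((m : ℤ) - 1) * (-1) ^ (m + 1) = 1 := by
    rw [zpow_sub₀ (by norm_num), zpow_natCast, zpow_one, pow_succ]
    linear_combination (pow_mul_pow_eq_one m (by norm_num : (-1 : ℂ) * -1 = 1))
  convert hs using 1
  · funext n
    rw [qTerm, pow_add, pow_mul, mul_assoc (qPoch (-q) q n)]
  · rw [← pow_triangle_mul_qSeries hq, div_mul_eq_mul_div, div_eq_iff hne, qSeries]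
    linear_combination (q ^ (m * (m - 1) / 2) * ∑' n, qTerm q (-q) (q ^ m) n) * hsign
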